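/- Let $H=H_3(\mathbb{Z})=\langle x,y,z\mid [x,y]=z,\ [x,z]=1,\ [y,z]=1\rangle$ be the integral Heisenberg group, where $[a,b]=aba^{-1}b^{-1}$. Let $k\ge 1$ be an integer, let $\mathcal{H}_k=H/\langle z^k\rangle$, and put $N=1+z+\cdots+z^{k-1}\in\mathbb{Z}\mathcal{H}_k$. Modules are left modules, and an $n\times m$ matrix $A$ over $\mathbb{Z}\mathcal{H}_k$ denotes the homomorphism $(\mathbb{Z}\mathcal{H}_k)^n\to(\mathbb{Z}\mathcal{H}_k)^m$, $v\mapsto vA$, on row vectors. Let $\varepsilon:\mathbb{Z}\mathcal{H}_k\to\mathbb{Z}$ be the augmentation map, and let \[ \partial_1=\begin{bmatrix} x-1\\ y-1\\ z-1\end{bmatrix},\qquad \partial_2=\begin{bmatrix} 0&0&N\\ 1-zy&x-z&-1\\ 1-z&0&x-1\\ 0&1-z&y-1\end{bmatrix}, \] \[ \partial_3=\begin{bmatrix} x-1&0&-N&0\\ y-1&0&0&-N\\ z-1&0&0&0\\ 0&z-1&1-zy&x-z\end{bmatrix},\qquad \partial_4=\begin{bmatrix} 0&0&N&0\\ 1-zy&x-z&-1&N\\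 1-z&0&x-1&0\\ 0&1-z&y-1&0\end{bmatrix}. \] Then the sequence \[ \cdots\xrightarrow{\partial_3}(\mathbb{Z}\mathcal{H}_k)^4\xrightarrow{\partial_4}(\mathbb{Z}\mathcal{H}_k)^4\xrightarrow{\partial_3}(\mathbb{Z}\mathcal{H}_k)^4\xrightarrow{\partial_2}(\mathbb{Z}\mathcal{H}_k)^3\xrightarrow{\partial_1}\mathbb{Z}\mathcal{H}_k\xrightarrow{\varepsilon}\mathbb{Z}\to 0, \] in which $\partial_3$ and $\partial_4$ alternate from degree $3$ on, is exact, i.e. it is a free resolution of the trivial $\mathbb{Z}\mathcal{H}_k$-module $\mathbb{Z}$. It is $2$-periodic in degrees $\ge 2$ (modules and differentials repeat with period $2$ there), with stable rank $4$ (every module in degree $\ge 2$ is free of rank $4$). -/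

import Mathlib

/-! ### Free resolutions -/

section Resolutions

variable {R : Type*} [Ring R] {N : Type*} [AddCommGroup N] [Module R N]
  {X : ℕ → Type*} [∀ n, AddCommGroup (X n)] [∀ n, Module R (X n)]

/-- The sequence `⋯ → X 2 → X 1 → X 0 → N → 0` of left `R`-modules, with differentials
`d n : X (n + 1) → X n` and augmentation `ε : X 0 → N`, is a free resolution of `N`:
all `X n` are free and the sequence is exact. -/
structure IsFreeResolution (d : ∀ n, X (n + 1) →ₗ[R] X n) (ε : X 0 →ₗ[R] N) : Prop where
  free : ∀ n, Module.Free R (X n)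
  surjective : Function.Surjective ε
  exact_zero : Function.Exact (d 0) ε
  exact_succ : ∀ n, Function.Exact (d (n + 1)) (d n)

/-- The sequence `d n : X (n + 1) → X n` is `p`-periodic in degrees `≥ m`: there are isomorphisms
`X (p + j) ≃ X j` for all `j ≥ m`, compatible with the differentials between modules of
degree `≥ m`. -/
def IsPeriodicFrom (p m : ℕ) (d : ∀ n, X (n + 1) →ₗ[R] X n) : Prop :=
  ∃ e : ∀ j, m ≤ j → (X (p + j) ≃ₗ[R] X j), ∀ (j : ℕ) (hj : m ≤ j) (v : X (p + (j + 1))),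
    e j hj (d (p + j) v) = d j (e (j + 1) (Nat.le_succ_of_le hj) v)

end Resolutions

/-- The modules `X j` are free of rank `r` for all `j ≥ m`, i.e. `X j ≅ R ^ r`. -/
def HasStableRankFrom (R : Type*) [Ring R] (X : ℕ → Type*) [∀ n, AddCommGroup (X n)]
    [∀ n, Module R (X n)] (m r : ℕ) : Prop :=
  ∀ j, m ≤ j → Nonempty (X j ≃ₗ[R] (Fin r → R))

namespace Heisenberg

open scoped commutatorElement

/-! ### The integral Heisenberg group and its central quotients -/

/-- The three generators of the integral Heisenberg group. -/
inductive Gen : Type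
  | x
  | y
  | z

/-- The relators `[x, y] z⁻¹`, `[x, z]`, `[y, z]`, where `⁅a, b⁆ = a * b * a⁻¹ * b⁻¹`. -/
def rels : Set (FreeGroup Gen) :=
  {⁅FreeGroup.of Gen.x, FreeGroup.of Gen.y⁆ * (FreeGroup.of Gen.z)⁻¹,
    ⁅FreeGroup.of Gen.x, FreeGroup.of Gen.z⁆,
    ⁅FreeGroup.of Gen.y, FreeGroup.of Gen.z⁆}

/-- The integral Heisenberg group
`H₃(ℤ) = ⟨x, y, z | [x, y] = z, [x, z] = 1, [y, z] = 1⟩`. -/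
abbrev H3 : Type := PresentedGroup rels

/-- The generator `z` is central in `H₃(ℤ)`. -/
theorem of_z_mem_center : (PresentedGroup.of Gen.z : H3) ∈ Subgroup.center H3 := by
  have key : ∀ g : H3, g ∈ Subgroup.centralizer {(PresentedGroup.of Gen.z : H3)} := by
    apply PresentedGroup.generated_by
    intro j
    rw [Subgroup.mem_centralizer_singleton_iff]
    cases j with
    | x =>
      have h := PresentedGroup.one_of_mem (rels := rels)
        (x := ⁅FreeGroup.of Gen.x, FreeGroup.of Gen.z⁆) (by simp [rels])
      rw [map_commutatorElement, commutatorElement_eq_one_iff_mul_comm] at h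
      exact h
    | y =>
      have h := PresentedGroup.one_of_mem (rels := rels)
        (x := ⁅FreeGroup.of Gen.y, FreeGroup.of Gen.z⁆) (by simp [rels])
      rw [map_commutatorElement, commutatorElement_eq_one_iff_mul_comm] at h
      exact h
    | z => rfl
  rw [Subgroup.mem_center_iff]
  intro g
  exact Subgroup.mem_centralizer_singleton_iff.mp (key g)

/-- The subgroup `⟨z ^ k⟩` of `H₃(ℤ)` is central, hence normal. -/
instance zpowers_normal (k : ℕ) :
    (Subgroup.zpowers ((PresentedGroup.of Gen.z : H3) ^ k)).Normal := by
  constructor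
  intro n hn g
  have hc : n ∈ Subgroup.center H3 :=
    (Subgroup.zpowers_le.mpr (Subgroup.pow_mem _ of_z_mem_center k)) hn
  rw [Subgroup.mem_center_iff.mp hc g, mul_inv_cancel_right]
  exact hn

/-- The central quotient `H_k = H₃(ℤ) / ⟨z ^ k⟩`. -/
abbrev Hk (k : ℕ) : Type := H3 ⧸ Subgroup.zpowers ((PresentedGroup.of Gen.z : H3) ^ k)

/-- The integral group ring `ℤ H_k`. -/
abbrev ZHk (k : ℕ) : Type := MonoidAlgebra ℤ (Hk k)

/-- The image of a generator of `H₃(ℤ)` in the group ring `ℤ H_k`. -/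
noncomputable def gen (k : ℕ) (a : Gen) : ZHk k :=
  MonoidAlgebra.of ℤ (Hk k) (QuotientGroup.mk (PresentedGroup.of a))

/-- The element `x` of `ℤ H_k`. -/
noncomputable abbrev x (k : ℕ) : ZHk k := gen k Gen.x

/-- The element `y` of `ℤ H_k`. -/
noncomputable abbrev y (k : ℕ) : ZHk k := gen k Gen.y

/-- The element `z` of `ℤ H_k`. -/
noncomputable abbrev z (k : ℕ) : ZHk k := gen k Gen.z

/-- The norm-like element `1 + z + ⋯ + z ^ (k - 1)` of `ℤ H_k`. -/
noncomputable def nu (k : ℕ) : ZHk k := ∑ i ∈ Finset.range k, z k ^ i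

/-! ### The differentials

An `n × m` matrix over `ℤ H_k` stands for the homomorphism of left modules
`(ℤ H_k) ^ n → (ℤ H_k) ^ m` that sends a row vector `v` to `v * A`. -/

/-- The matrix `∂₁`. -/
noncomputable def D1 (k : ℕ) : Matrix (Fin 3) (Fin 1) (ZHk k) :=
  !![x k - 1;
     y k - 1;
     z k - 1]

/-- The matrix `∂₂`. -/
noncomputable def D2 (k : ℕ) : Matrix (Fin 4) (Fin 3) (ZHk k) :=
  !![0, 0, nu k;
     1 - z k * y k, x k - z k, -1;
     1 - z k, 0, x k - 1;
     0, 1 - z k, y k - 1]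

/-- The matrix `∂₃`. -/
noncomputable def D3 (k : ℕ) : Matrix (Fin 4) (Fin 4) (ZHk k) :=
  !![x k - 1, 0, -nu k, 0;
     y k - 1, 0, 0, -nu k;
     z k - 1, 0, 0, 0;
     0, z k - 1, 1 - z k * y k, x k - z k]

/-- The matrix `∂₄`. -/
noncomputable def D4 (k : ℕ) : Matrix (Fin 4) (Fin 4) (ZHk k) :=
  !![0, 0, nu k, 0;
     1 - z k * y k, x k - z k, -1, nu k;
     1 - z k, 0, x k - 1, 0;
     0, 1 - z k, y k - 1, 0]

/-- The ranks `1, 3, 4, 4, 4, …` of the free modules in the resolution. -/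
def rk : ℕ → ℕ
  | 0 => 1
  | 1 => 3
  | _ + 2 => 4

/-- The matrix of the differential from degree `n + 1` to degree `n`: `∂₁, ∂₂`, and then
`∂₃` (from odd to even degrees) and `∂₄` (from even to odd degrees) alternately. -/
noncomputable def diffMatrix (k : ℕ) :
    ∀ n : ℕ, Matrix (Fin (rk (n + 1))) (Fin (rk n)) (ZHk k)
  | 0 => D1 k
  | 1 => D2 k
  | n + 2 => if Even n then D3 k else D4 k

/-- The free module `(ℤ H_k) ^ (rk n)` of row vectors, in degree `n`. -/
abbrev M (k n : ℕ) : Type := Fin (rk n) → ZHk k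

/-- The differential from degree `n + 1` to degree `n`, i.e. `v ↦ v * A` for the matrix above. -/
noncomputable def diff (k n : ℕ) : M k (n + 1) →ₗ[ZHk k] M k n :=
  (diffMatrix k n).vecMulLinear

/-- The trivial left `ℤ H_k`-module `ℤ`. -/
abbrev TrivialModule (k : ℕ) : Type := (Representation.trivial ℤ (Hk k) ℤ).asModule

/-- The canonical augmentation `ε : ℤ H_k → ℤ`, `r ↦ r • 1`. -/
noncomputable def augmentation (k : ℕ) : M k 0 →ₗ[ZHk k] TrivialModule k :=
  (LinearMap.toSpanSingleton (ZHk k) (TrivialModule k)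
    ((Representation.trivial ℤ (Hk k) ℤ).asModuleEquiv.symm 1)).comp
  (LinearMap.proj (0 : Fin 1))

/-- The augmentation sends a group element to `1`. -/
theorem augmentation_of (k : ℕ) (g : Hk k) :
    (Representation.trivial ℤ (Hk k) ℤ).asModuleEquiv
      (augmentation k (fun _ => MonoidAlgebra.of ℤ (Hk k) g)) = 1 := by
  change (Representation.trivial ℤ (Hk k) ℤ).asModuleEquiv (MonoidAlgebra.of ℤ (Hk k) g •
    (Representation.trivial ℤ (Hk k) ℤ).asModuleEquiv.symm 1) = 1
  rw [Representation.asModuleEquiv_map_smul]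
  simp

end Heisenberg

/-! Write R = ℤH_k. Since z has order exactly k, the right multiplications by z - 1 and by N on R
have kernels R N and R (z - 1) respectively (`exists_eq_mul_sum_pow`,
`exists_eq_mul_sub_one_of_mul_sum_pow`). Moreover H_k / ⟨z⟩ = ℤ², so R / R (z - 1) = ℤ[ℤ²]
(`exists_of_projRing_eq_zero`), a domain over which the Koszul complex on x - 1, y - 1 is exact
(`koszul_exact`).

The matrices splice this Koszul complex with the periodic resolution of the cyclic group ⟨z⟩. A
cycle in degree 1 or in even degree ≥ 2 is solved modulo z - 1, lifted to R, and the errors are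
absorbed by the two annihilator facts; in odd degree ≥ 3 those two facts suffice. The computations
close because of the identity (1 - zy)(x - 1) + (x - z)(y - 1) = z - 1, a form of xy = zyx. In
degree 0 the point is that the elements g - 1, for g a generator, generate the augmentation ideal.
-/

namespace Heisenberg

/-! ### Solving the boundary equations from annihilator facts in an abstract ring -/

section Elimination

/-- Relations satisfied by the elements `x, y, z` and `N = 1 + z + ⋯ + z ^ (k - 1)` of `ℤ H_k`. -/
structure Relations {R : Type*} [Ring R] (x y z N : R) : Prop where
  xy : x * y = z * (y * x)
  xz : x * z = z * x
  yz : y * z = z * y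
  xN : x * N = N * x
  yN : y * N = N * y
  Nz : N * z = N
  zN : z * N = N

variable {R : Type*} [Ring R] {x y z N : R}

theorem mul_left_absorb {a b c : R} (h : a * b = c) (w : R) : a * (b * w) = c * w := by
  rw [← mul_assoc, h]

namespace Relations

/-- The Koszul hypothesis settles a and b. By (1 - zy)(x - 1) + (x - z)(y - 1) = z - 1, the equation
becomes (c + q - r(x - 1) - s(y - 1))(z - 1) = 0, so the defect in c is a multiple of N. -/
theorem exists_of_degree_one (H : Relations x y z N)
    (hker : ∀ r : R, r * (z - 1) = 0 → ∃ s, r = s * N)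
    (hkoszul : ∀ a b c : R, a * (x - 1) + b * (y - 1) + c * (z - 1) = 0 →
      ∃ r s s' : R, a = r * (1 - z * y) + s * (1 - z) ∧ b = r * (x - z) + s' * (1 - z))
    {a b c : R} (h : a * (x - 1) + b * (y - 1) + c * (z - 1) = 0) :
    ∃ p q r s : R, q * (1 - z * y) + r * (1 - z) = a ∧ q * (x - z) + s * (1 - z) = b ∧
      p * N - q + r * (x - 1) + s * (y - 1) = c := by
  obtain ⟨q, r, s, rfl, rfl⟩ := hkoszul a b c h
  obtain ⟨p, hp⟩ := hker (c + q - r * (x - 1) - s * (y - 1)) (by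
    rw [← h]
    simp only [mul_sub, sub_mul, add_mul, mul_one, mul_assoc, H.xy, H.xz, H.yz]
    abel)
  exact ⟨p, q, r, s, rfl, rfl, by rw [← hp]; abel⟩

/-- Once b = s(z - 1), the first two equations say that the defects of c and d are killed by z - 1,
and the third becomes (a + p(x - 1) + q(y - 1))N = 0. The extra equation bN = 0 coming from ∂₄ is
implied by b = s(z - 1), so this covers both ∂₂ and ∂₄. -/
theorem exists_of_even_degree (H : Relations x y z N)
    (hker : ∀ r : R, r * (z - 1) = 0 → ∃ s, r = s * N)
    (hkerN : ∀ r : R, r * N = 0 → ∃ s, r = s * (z - 1))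
    (hreg : ∀ b c : R, b * (1 - z * y) + c * (1 - z) = 0 → ∃ s, b = s * (z - 1))
    {a b c d : R} (h₀ : b * (1 - z * y) + c * (1 - z) = 0)
    (h₁ : b * (x - z) + d * (1 - z) = 0)
    (h₂ : a * N - b + c * (x - 1) + d * (y - 1) = 0) :
    ∃ p q r s : R, p * (x - 1) + q * (y - 1) + r * (z - 1) = a ∧ s * (z - 1) = b ∧
      -(p * N) + s * (1 - z * y) = c ∧ -(q * N) + s * (x - z) = d := by
  obtain ⟨s, rfl⟩ := hreg b c h₀
  obtain ⟨p, hp⟩ := hker (c - s * (1 - z * y)) (by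
    rw [← neg_eq_zero, ← h₀]
    simp only [mul_sub, sub_mul, mul_one, mul_assoc, H.yz]
    abel)
  obtain ⟨q, hq⟩ := hker (d - s * (x - z)) (by
    rw [← neg_eq_zero, ← h₁]
    simp only [mul_sub, sub_mul, mul_one, mul_assoc, H.xz]
    abel)
  obtain rfl : c = p * N + s * (1 - z * y) := by rw [← hp]; abel
  obtain rfl : d = q * N + s * (x - z) := by rw [← hq]; abel
  obtain ⟨r, hr⟩ := hkerN (a + p * (x - 1) + q * (y - 1)) (by
    rw [← h₂]
    simp only [mul_sub, sub_mul, add_mul, mul_one, mul_assoc, H.xy, H.xN, H.yN]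
    abel)
  exact ⟨-p, -q, r, s, by rw [← hr]; noncomm_ring, rfl, by noncomm_ring, by noncomm_ring⟩

/-- From d = qN, the last two equations say that N kills a - q(1 - zy) and b - q(x - z), which are
thus multiples of z - 1. The first equation then determines c up to a multiple of N, as in degree
one. -/
theorem exists_of_odd_degree (H : Relations x y z N)
    (hker : ∀ r : R, r * (z - 1) = 0 → ∃ s, r = s * N)
    (hkerN : ∀ r : R, r * N = 0 → ∃ s, r = s * (z - 1))
    {a b c d : R} (h₀ : a * (x - 1) + b * (y - 1) + c * (z - 1) = 0) (h₁ : d * (z - 1) = 0)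
    (h₂ : -(a * N) + d * (1 - z * y) = 0) (h₃ : -(b * N) + d * (x - z) = 0) :
    ∃ p q r s : R, q * (1 - z * y) + r * (1 - z) = a ∧ q * (x - z) + s * (1 - z) = b ∧
      p * N - q + r * (x - 1) + s * (y - 1) = c ∧ q * N = d := by
  obtain ⟨q, rfl⟩ := hker d h₁
  obtain ⟨r, hr⟩ := hkerN (a - q * (1 - z * y)) (by
    rw [← neg_eq_zero, ← h₂]
    simp only [mul_sub, sub_mul, mul_one, mul_assoc, H.yN, mul_left_absorb H.zN,
      mul_left_absorb H.Nz]
    abel)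
  obtain ⟨s, hs⟩ := hkerN (b - q * (x - z)) (by
    rw [← neg_eq_zero, ← h₃]
    simp only [mul_sub, sub_mul, mul_assoc, H.xN, H.zN, H.Nz]
    abel)
  obtain rfl : a = q * (1 - z * y) + r * (z - 1) := by rw [← hr]; abel
  obtain rfl : b = q * (x - z) + s * (z - 1) := by rw [← hs]; abel
  obtain ⟨p, hp⟩ := hker (c + q + r * (x - 1) + s * (y - 1)) (by
    rw [← h₀]
    simp only [mul_sub, sub_mul, add_mul, mul_one, mul_assoc, H.xy, H.xz, H.yz]
    abel)
  exact ⟨p, q, -r, -s, by noncomm_ring, by noncomm_ring, by rw [← hp]; noncomm_ring, rfl⟩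

end Relations

end Elimination

open MonoidAlgebra

/-! ### Annihilators and kernels in integral group rings -/

section GroupRing

variable {G Q A : Type*} [AddCommGroup A]

/-- The additive extension of a map `G → A` to `ℤ[G]`. -/
noncomputable def additiveExtension (f : G → A) : MonoidAlgebra ℤ G →+ A :=
  (Finsupp.liftAddHom fun g => zmultiplesHom A (f g)).comp coeffAddEquiv.toAddMonoidHom

@[simp]
theorem additiveExtension_single (f : G → A) (g : G) :
    additiveExtension f (single g 1) = f g := by
  simp [additiveExtension, coeffAddEquiv]

theorem addMonoidHom_eq_of_single {f g : MonoidAlgebra ℤ G →+ A}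
    (h : ∀ a, f (single a 1) = g (single a 1)) : f = g := by
  ext a
  simpa using h a

/-- Modulo L, a basis element depends only on its image under f, so the quotient map by L factors
through `mapDomain f`. Here f is only a map of sets. -/
theorem mem_of_mapDomain_eq_zero {f : G → Q} {L : AddSubgroup (MonoidAlgebra ℤ G)}
    (hL : ∀ g h, f g = f h → (single g 1 - single h 1 : MonoidAlgebra ℤ G) ∈ L)
    {r : MonoidAlgebra ℤ G} (hr : mapDomain f r = 0) : r ∈ L := by
  classical
  let p := QuotientAddGroup.mk' L
  -- The factorization sends q to the class of any preimage; the value 0 off the range of f plays no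
  -- role.
  let F : Q → MonoidAlgebra ℤ G ⧸ L := fun q =>
    if h : ∃ g, f g = q then p (single h.choose 1) else 0
  let m : MonoidAlgebra ℤ G →+ MonoidAlgebra ℤ Q :=
    ⟨⟨mapDomain f, mapDomain_zero f⟩, mapDomain_add f⟩
  have key : (additiveExtension F).comp m = p := by
    refine addMonoidHom_eq_of_single fun a => ?_
    have hex : ∃ g, f g = f a := ⟨a, rfl⟩
    change additiveExtension F (mapDomain f (single a 1)) = _
    rw [mapDomain_single, additiveExtension_single]
    simp only [F, dif_pos hex]
    rw [← sub_eq_zero, ← map_sub]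
    exact (QuotientAddGroup.eq_zero_iff _).mpr (hL _ _ hex.choose_spec)
  have h0 : p r = 0 := by
    rw [← key]
    change additiveExtension F (mapDomain f r) = 0
    rw [hr, map_zero]
  exact (QuotientAddGroup.eq_zero_iff _).mp h0

variable [Group G]

/-- The subgroup of those `g` with `g - 1` in a given left ideal of `ℤ[G]`. -/
def subgroupOfIdeal (L : Ideal (MonoidAlgebra ℤ G)) : Subgroup G where
  carrier := {g | of ℤ G g - 1 ∈ L}
  one_mem' := by simp only [Set.mem_ofPred_eq, map_one, sub_self, L.zero_mem]
  mul_mem' {g h} hg hh := by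
    have : of ℤ G (g * h) - 1 = of ℤ G g * (of ℤ G h - 1) + (of ℤ G g - 1) := by
      rw [map_mul]; noncomm_ring
    simp only [Set.mem_ofPred_eq, this]
    exact L.add_mem (L.mul_mem_left _ hh) hg
  inv_mem' {g} hg := by
    have : of ℤ G g⁻¹ - 1 = -of ℤ G g⁻¹ * (of ℤ G g - 1) := by
      rw [mul_sub, neg_mul, ← map_mul, inv_mul_cancel, map_one]; noncomm_ring
    simp only [Set.mem_ofPred_eq, this]
    exact L.mul_mem_left _ hg

theorem single_sub_single_mem {L : Ideal (MonoidAlgebra ℤ G)} {g h : G}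
    (H : h⁻¹ * g ∈ subgroupOfIdeal L) : (single g 1 - single h 1 : MonoidAlgebra ℤ G) ∈ L := by
  have : (single g 1 - single h 1 : MonoidAlgebra ℤ G) =
      of ℤ G h * (of ℤ G (h⁻¹ * g) - 1) := by
    rw [mul_sub, ← map_mul, mul_inv_cancel_left, mul_one]; rfl
  rw [this]
  exact L.mul_mem_left _ H

/-- Each fibre of f lies in one left coset of ⟨z⟩, and g - h = h(h⁻¹g - 1) lies in the left ideal of
z - 1 as soon as h⁻¹g ∈ ⟨z⟩. -/
theorem exists_eq_mul_sub_one {f : G → Q} {z : G}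
    (hf : ∀ g h, f g = f h → h⁻¹ * g ∈ Subgroup.zpowers z)
    {r : MonoidAlgebra ℤ G} (hr : mapDomain f r = 0) : ∃ s, r = s * (of ℤ G z - 1) := by
  let L : Ideal (MonoidAlgebra ℤ G) := Ideal.span {of ℤ G z - 1}
  have hz : Subgroup.zpowers z ≤ subgroupOfIdeal L :=
    Subgroup.zpowers_le.mpr (Ideal.subset_span rfl)
  have hmem : r ∈ L := mem_of_mapDomain_eq_zero (L := L.toAddSubgroup)
    (fun g h hgh => single_sub_single_mem (hz (hf g h hgh))) hr
  obtain ⟨s, hs⟩ := Ideal.mem_span_singleton'.mp hmem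
  exact ⟨s, hs.symm⟩

/-- S consists of one chosen representative per left coset of ⟨w⟩, so it meets each cycle g, gw,
gw², … exactly once per period. -/
theorem exists_transversal {w : G} (hw : IsOfFinOrder w) :
    ∃ S : Set G, ∀ g, ∃ i ∈ Finset.range (orderOf w),
      ∀ j ∈ Finset.range (orderOf w), g * w ^ j ∈ S ↔ j = i := by
  classical
  refine ⟨{g | (QuotientGroup.mk g : G ⧸ Subgroup.zpowers w).out = g}, fun g => ?_⟩
  obtain ⟨⟨h, hh⟩, hgh⟩ := QuotientGroup.mk_out_eq_mul (Subgroup.zpowers w) g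
  rw [hw.mem_zpowers_iff_mem_range_orderOf, Finset.mem_image] at hh
  obtain ⟨i, hi, rfl⟩ := hh
  refine ⟨i, hi, fun j hj => ?_⟩
  have : (QuotientGroup.mk (g * w ^ j) : G ⧸ Subgroup.zpowers w) = QuotientGroup.mk g :=
    QuotientGroup.mk_mul_of_mem g (Subgroup.npow_mem_zpowers w j)
  rw [Set.mem_ofPred_eq, this, hgh]
  simp only [mul_right_inj]
  constructor
  · intro h
    exact pow_injOn_Iio_orderOf (by simpa using hj) (by simpa using hi) h.symm
  · rintro rfl; rfl

/-- With κ the restriction of coefficients to a transversal, every r equals Σ κ(r z⁻ⁱ) zⁱ. If rz =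
r, this sum is κ(r) Σ zⁱ. -/
theorem exists_eq_mul_sum_pow {z : G} (hz : IsOfFinOrder z) {r : MonoidAlgebra ℤ G}
    (hr : r * (of ℤ G z - 1) = 0) :
    ∃ s, r = s * ∑ i ∈ Finset.range (orderOf z), of ℤ G z ^ i := by
  classical
  obtain ⟨S, hS⟩ := exists_transversal hz.inv
  rw [orderOf_inv] at hS
  let κ : MonoidAlgebra ℤ G →+ MonoidAlgebra ℤ G :=
    additiveExtension fun g => if g ∈ S then single g 1 else 0
  let Φ : MonoidAlgebra ℤ G →+ MonoidAlgebra ℤ G :=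
    ∑ i ∈ Finset.range (orderOf z), (AddMonoidHom.mulRight (of ℤ G z ^ i)).comp
      (κ.comp (AddMonoidHom.mulRight (of ℤ G (z⁻¹ ^ i))))
  have hΦ : Φ = AddMonoidHom.id _ := by
    refine addMonoidHom_eq_of_single fun g => ?_
    obtain ⟨i, hi, hij⟩ := hS g
    simp only [Φ, AddMonoidHom.finsetSum_apply, AddMonoidHom.comp_apply,
      AddMonoidHom.coe_mulRight, AddMonoidHom.id_apply, of_apply, single_mul_single, mul_one, κ,
      additiveExtension_single]
    rw [Finset.sum_eq_single_of_mem i hi]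
    · rw [if_pos ((hij i hi).mpr rfl), ← of_apply, ← of_apply, ← map_pow, ← map_mul]
      simp
    · intro j hj hne
      rw [if_neg (mt (hij j hj).mp hne), zero_mul]
  have hrz : r * of ℤ G z = r := by rwa [mul_sub, mul_one, sub_eq_zero] at hr
  have hrz' : ∀ i : ℕ, r * of ℤ G (z⁻¹ ^ i) = r := by
    have h1 : r * of ℤ G z⁻¹ = r := by
      conv_lhs => rw [← hrz, mul_assoc, ← map_mul, mul_inv_cancel, map_one, mul_one]
    intro i
    induction i with
    | zero => rw [pow_zero, map_one, mul_one]
    | succ i ih => rw [pow_succ, map_mul, ← mul_assoc, ih, h1]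
  refine ⟨κ r, ?_⟩
  conv_lhs => rw [← AddMonoidHom.id_apply (MonoidAlgebra ℤ G) r, ← hΦ]
  simp only [Φ, AddMonoidHom.finsetSum_apply, AddMonoidHom.comp_apply,
    AddMonoidHom.coe_mulRight, hrz', Finset.mul_sum]

/-- Among the terms of g Σ zⁱ exactly one lies in the transversal, so restricting to it and passing
to cosets recovers the class of g. Hence r Σ zⁱ = 0 forces r to vanish on the coset space. -/
theorem exists_eq_mul_sub_one_of_mul_sum_pow {z : G} (hz : IsOfFinOrder z)
    {r : MonoidAlgebra ℤ G}
    (hr : r * ∑ i ∈ Finset.range (orderOf z), of ℤ G z ^ i = 0) :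
    ∃ s, r = s * (of ℤ G z - 1) := by
  classical
  obtain ⟨S, hS⟩ := exists_transversal hz
  let π : G → G ⧸ Subgroup.zpowers z := QuotientGroup.mk
  let ρ : MonoidAlgebra ℤ G →+ MonoidAlgebra ℤ (G ⧸ Subgroup.zpowers z) :=
    additiveExtension fun g => if g ∈ S then single (π g) 1 else 0
  let m : MonoidAlgebra ℤ G →+ MonoidAlgebra ℤ (G ⧸ Subgroup.zpowers z) :=
    ⟨⟨mapDomain π, mapDomain_zero π⟩, mapDomain_add π⟩
  have hρ : ρ.comp (AddMonoidHom.mulRight (∑ i ∈ Finset.range (orderOf z), of ℤ G z ^ i)) = m := by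
    refine addMonoidHom_eq_of_single fun g => ?_
    obtain ⟨i, hi, hij⟩ := hS g
    change _ = mapDomain π (single g 1)
    simp only [AddMonoidHom.comp_apply, AddMonoidHom.coe_mulRight, ← map_pow, Finset.mul_sum,
      map_sum, mapDomain_single]
    simp only [of_apply, single_mul_single, mul_one, ρ, additiveExtension_single]
    rw [Finset.sum_eq_single_of_mem i hi]
    · rw [if_pos ((hij i hi).mpr rfl)]
      congr 1
      exact QuotientGroup.mk_mul_of_mem g (Subgroup.npow_mem_zpowers z i)
    · intro j hj hne
      rw [if_neg (mt (hij j hj).mp hne)]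
  refine exists_eq_mul_sub_one (f := π) (fun g h hgh => QuotientGroup.eq.mp hgh.symm) ?_
  change m r = 0
  rw [← hρ]
  exact (congrArg ρ hr).trans (map_zero ρ)

end GroupRing

open scoped commutatorElement

/-! ### The group H_k: the order of z and the quotient ℤ² -/

section Group

/-- The image of a generator of `H₃(ℤ)` in `H_k`. -/
def ofGen (k : ℕ) (a : Gen) : Hk k := QuotientGroup.mk (PresentedGroup.of a)

theorem commute_xz (k : ℕ) : ofGen k .x * ofGen k .z = ofGen k .z * ofGen k .x := by
  exact congrArg QuotientGroup.mk (Subgroup.mem_center_iff.mp of_z_mem_center _)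

theorem commute_yz (k : ℕ) : ofGen k .y * ofGen k .z = ofGen k .z * ofGen k .y := by
  exact congrArg QuotientGroup.mk (Subgroup.mem_center_iff.mp of_z_mem_center _)

theorem ofGen_xy (k : ℕ) : ofGen k .x * ofGen k .y = ofGen k .z * (ofGen k .y * ofGen k .x) := by
  have h := PresentedGroup.one_of_mem (rels := rels)
    (x := ⁅FreeGroup.of Gen.x, FreeGroup.of Gen.y⁆ * (FreeGroup.of Gen.z)⁻¹) (by simp [rels])
  rw [map_mul, map_inv, map_commutatorElement, mul_inv_eq_one, commutatorElement_def,
    mul_inv_eq_iff_eq_mul, mul_inv_eq_iff_eq_mul, mul_assoc] at h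
  exact congrArg QuotientGroup.mk h

theorem ofGen_z_pow (k : ℕ) : ofGen k .z ^ k = 1 :=
  (QuotientGroup.eq_one_iff _).mpr (Subgroup.mem_zpowers _)

/-- The homomorphism `H_k → P` determined by images of the generators. -/
def lift {P : Type*} [Group P] (k : ℕ) (f : Gen → P) (hxy : ⁅f .x, f .y⁆ = f .z)
    (hxz : ⁅f .x, f .z⁆ = 1) (hyz : ⁅f .y, f .z⁆ = 1) (hz : f .z ^ k = 1) : Hk k →* P :=
  QuotientGroup.lift _ (PresentedGroup.toGroup (f := f) (rels := rels) (by
    rintro r (rfl | rfl | rfl) <;> simp [map_commutatorElement, *])) (by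
    change _ ≤ MonoidHom.ker _
    rw [Subgroup.zpowers_le, MonoidHom.mem_ker, map_pow, PresentedGroup.toGroup.of, hz])

theorem lift_ofGen {P : Type*} [Group P] (k : ℕ) (f : Gen → P) (hxy : ⁅f .x, f .y⁆ = f .z)
    (hxz : ⁅f .x, f .z⁆ = 1) (hyz : ⁅f .y, f .z⁆ = 1) (hz : f .z ^ k = 1) (a : Gen) :
    lift k f hxy hxz hyz hz (ofGen k a) = f a := by
  simp [lift, ofGen]

theorem closure_range_ofGen (k : ℕ) : Subgroup.closure (Set.range (ofGen k)) = ⊤ := by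
  have h := PresentedGroup.closure_range_of rels
  have := congrArg (Subgroup.map (QuotientGroup.mk' (Subgroup.zpowers
    ((PresentedGroup.of Gen.z : H3) ^ k)))) h
  rw [MonoidHom.map_closure, ← Set.range_comp, Subgroup.map_top_of_surjective _
    (QuotientGroup.mk'_surjective _)] at this
  exact this

theorem hom_ext {P : Type*} [Group P] {k : ℕ} {f g : Hk k →* P}
    (h : ∀ a, f (ofGen k a) = g (ofGen k a)) : f = g :=
  MonoidHom.eq_of_eqOn_dense (closure_range_ofGen k) (by rintro _ ⟨a, rfl⟩; exact h a)

/-- The action of the generators on `(ℤ/k)²` in which `z` is a translation. -/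
def permGen (k : ℕ) : Gen → Equiv.Perm (ZMod k × ZMod k)
  | .x => ⟨fun p => (p.1 + p.2, p.2), fun p => (p.1 - p.2, p.2), fun p => by simp,
      fun p => by simp⟩
  | .y => Equiv.addRight (0, 1)
  | .z => Equiv.addRight (1, 0)

theorem permGen_z_pow (k n : ℕ) (p : ZMod k × ZMod k) :
    (permGen k .z ^ n) p = p + ((n : ZMod k), 0) := by
  induction n with
  | zero => simp
  | succ n ih =>
    rw [pow_succ', Equiv.Perm.mul_apply, ih]
    ext <;> simp [permGen, add_assoc]

/-- That the order is not smaller is seen on (ℤ/k)², where x acts as a shear and z as translation by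
(1, 0). -/
theorem orderOf_ofGen_z (k : ℕ) : orderOf (ofGen k .z) = k := by
  refine Nat.dvd_antisymm (orderOf_dvd_of_pow_eq_one (ofGen_z_pow k)) ?_
  let φ := lift k (permGen k)
    (by
      rw [commutatorElement_def, mul_inv_eq_iff_eq_mul, mul_inv_eq_iff_eq_mul]
      ext p <;> simp [permGen]; ring)
    (by rw [commutatorElement_eq_one_iff_mul_comm]; ext p <;> simp [permGen]; ring)
    (by rw [commutatorElement_eq_one_iff_mul_comm]; ext p <;> simp [permGen])
    (by ext p <;> simp [permGen_z_pow])
  have h := congrArg φ (pow_orderOf_eq_one (ofGen k .z))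
  rw [map_pow, lift_ofGen, map_one] at h
  have h' := congrArg Prod.fst (DFunLike.congr_fun h (0, 0))
  rw [permGen_z_pow] at h'
  exact (ZMod.natCast_eq_zero_iff _ _).mp (by simpa using h')

/-- The free abelian group of rank two. -/
abbrev Z2 : Type := Multiplicative ℤ × Multiplicative ℤ

/-- Images of the generators of `H_k` in its quotient by `⟨z⟩`. -/
def abGen : Gen → Z2
  | .x => (Multiplicative.ofAdd 1, 1)
  | .y => (1, Multiplicative.ofAdd 1)
  | .z => 1

/-- The projection `H_k → ℤ²` with kernel `⟨z⟩`. -/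
def proj (k : ℕ) : Hk k →* Z2 :=
  lift k abGen (by rw [commutatorElement_eq_one_iff_mul_comm.mpr (mul_comm _ _)]; rfl)
    (commutatorElement_eq_one_iff_mul_comm.mpr (mul_comm _ _))
    (commutatorElement_eq_one_iff_mul_comm.mpr (mul_comm _ _)) (one_pow k)

theorem proj_ofGen (k : ℕ) (a : Gen) : proj k (ofGen k a) = abGen a := lift_ofGen ..

theorem zpowers_z_normal (k : ℕ) : (Subgroup.zpowers (ofGen k .z)).Normal := by
  have : ofGen k .z ∈ Subgroup.center (Hk k) := by
    have h : Subgroup.closure (Set.range (ofGen k)) ≤ Subgroup.centralizer {ofGen k .z} := by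
      rw [Subgroup.closure_le]
      rintro _ ⟨a, rfl⟩
      rw [SetLike.mem_coe, Subgroup.mem_centralizer_singleton_iff]
      cases a
      · exact commute_xz k
      · exact commute_yz k
      · rfl
    rw [closure_range_ofGen] at h
    exact Subgroup.mem_center_iff.mpr fun g =>
      Subgroup.mem_centralizer_singleton_iff.mp (h (Subgroup.mem_top g))
  exact ⟨fun n hn g => by
    rw [Subgroup.mem_center_iff.mp (Subgroup.zpowers_le.mpr this hn) g, mul_inv_cancel_right]
    exact hn⟩

/-- The images of x and y commute in H_k / ⟨z⟩, which gives θ from ℤ² to that quotient with θ ∘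
`proj k` the quotient map. -/
theorem proj_eq_iff {k : ℕ} {g h : Hk k} (hgh : proj k g = proj k h) :
    h⁻¹ * g ∈ Subgroup.zpowers (ofGen k .z) := by
  have := zpowers_z_normal k
  let π := QuotientGroup.mk' (Subgroup.zpowers (ofGen k .z))
  have hz : π (ofGen k .z) = 1 := (QuotientGroup.eq_one_iff _).mpr (Subgroup.mem_zpowers _)
  have hc : Commute (π (ofGen k .x)) (π (ofGen k .y)) := by
    rw [Commute, SemiconjBy, ← map_mul, ofGen_xy, map_mul, hz, one_mul, map_mul]
  let θ : Z2 →* Hk k ⧸ Subgroup.zpowers (ofGen k .z) :=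
    MonoidHom.noncommCoprod (zpowersHom _ (π (ofGen k .x))) (zpowersHom _ (π (ofGen k .y)))
      (fun m n => by simpa [zpowersHom_apply] using (hc.zpow_zpow _ _))
  have key : θ.comp (proj k) = π := by
    refine hom_ext fun a => ?_
    rw [MonoidHom.comp_apply, proj_ofGen]
    cases a
    · simp [θ, abGen, zpowersHom_apply]
    · simp [θ, abGen, zpowersHom_apply]
    · rw [hz]; exact map_one θ
  refine QuotientGroup.eq.mp ?_
  change π h = π g
  rw [← key, MonoidHom.comp_apply, MonoidHom.comp_apply, hgh]

theorem proj_surjective (k : ℕ) : Function.Surjective (proj k) := by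
  rintro ⟨i, j⟩
  refine ⟨ofGen k .x ^ i.toAdd * ofGen k .y ^ j.toAdd, ?_⟩
  rw [map_mul, map_zpow, map_zpow, proj_ofGen, proj_ofGen]
  ext <;> simp [abGen]

end Group

/-! ### Koszul exactness over ℤ[ℤ²] -/

section Koszul

theorem single_sub_one_ne_zero {G : Type*} [Monoid G] {g : G} (hg : g ≠ 1) :
    of ℤ G g - 1 ≠ 0 := by
  rw [sub_ne_zero, ← map_one (of ℤ G)]
  exact fun h => hg (of_injective h)

/-- Setting y = 1 leaves ᾱ(x - 1) = 0 in the domain ℤ[ℤ], so y - 1 divides α; cancelling y - 1 then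
determines β. -/
theorem koszul_exact {α β : MonoidAlgebra ℤ Z2}
    (h : α * (of ℤ Z2 (abGen .x) - 1) + β * (of ℤ Z2 (abGen .y) - 1) = 0) :
    ∃ ρ, α = ρ * (1 - of ℤ Z2 (abGen .y)) ∧ β = ρ * (of ℤ Z2 (abGen .x) - 1) := by
  let p := MonoidHom.fst (Multiplicative ℤ) (Multiplicative ℤ)
  have hx : p (abGen .x) ≠ 1 := by simp [p, abGen]
  have hy : abGen .y ≠ 1 := by simp [abGen]
  have hα : mapDomain p α = 0 := by
    have h' := congrArg (mapDomainRingHom ℤ p) h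
    have h1 : p (abGen .y) = 1 := rfl
    simp only [map_add, map_mul, map_sub, map_one, map_zero, of_apply, mapDomainRingHom_apply,
      mapDomain_single, h1] at h'
    rw [← one_def, sub_self, mul_zero, add_zero] at h'
    exact (mul_eq_zero.mp h').resolve_right (single_sub_one_ne_zero hx)
  obtain ⟨s, rfl⟩ := exists_eq_mul_sub_one (f := p) (z := abGen .y) (fun g h hgh => by
    refine ⟨(h⁻¹ * g).2.toAdd, ?_⟩
    change g.1 = h.1 at hgh
    ext <;> simp [abGen, hgh]) hα
  refine ⟨-s, by ring, mul_right_cancel₀ (single_sub_one_ne_zero hy) ?_⟩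
  linear_combination h

end Koszul

/-! ### Transfer of the annihilator and Koszul facts to ℤH_k -/

section Relations

theorem gen_eq (k : ℕ) (a : Gen) : gen k a = of ℤ (Hk k) (ofGen k a) := rfl

theorem nu_eq (k : ℕ) :
    nu k = ∑ i ∈ Finset.range (orderOf (ofGen k .z)), of ℤ (Hk k) (ofGen k .z) ^ i := by
  rw [orderOf_ofGen_z]; rfl

theorem commute_x_z (k : ℕ) : Commute (x k) (z k) := by
  rw [Commute, SemiconjBy, x, z, gen_eq, gen_eq, ← map_mul, commute_xz, map_mul]

theorem commute_y_z (k : ℕ) : Commute (y k) (z k) := by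
  rw [Commute, SemiconjBy, y, z, gen_eq, gen_eq, ← map_mul, commute_yz, map_mul]

theorem nu_mul_z_sub_one (k : ℕ) : nu k * (z k - 1) = 0 := by
  rw [nu, geom_sum_mul, sub_eq_zero, z, gen_eq, ← map_pow, ofGen_z_pow, map_one]

theorem relations (k : ℕ) : Relations (x k) (y k) (z k) (nu k) where
  xy := by rw [x, y, z, gen_eq, gen_eq, gen_eq, ← map_mul, ofGen_xy, map_mul, map_mul]
  xz := commute_x_z k
  yz := commute_y_z k
  xN := Commute.sum_right _ _ _ fun i _ => (commute_x_z k).pow_right i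
  yN := Commute.sum_right _ _ _ fun i _ => (commute_y_z k).pow_right i
  Nz := by simpa [mul_sub, sub_eq_zero] using nu_mul_z_sub_one k
  zN := by
    have h : Commute (z k) (nu k) :=
      Commute.sum_right _ _ _ fun i _ => (Commute.refl (z k)).pow_right i
    rw [h.eq]
    simpa [mul_sub, sub_eq_zero] using nu_mul_z_sub_one k

variable {k : ℕ}

theorem isOfFinOrder_z (hk : 1 ≤ k) : IsOfFinOrder (ofGen k .z) :=
  isOfFinOrder_iff_pow_eq_one.mpr ⟨k, hk, ofGen_z_pow k⟩

theorem exists_eq_mul_nu (hk : 1 ≤ k) (r : ZHk k) (h : r * (z k - 1) = 0) :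
    ∃ s, r = s * nu k := by
  rw [nu_eq]
  exact exists_eq_mul_sum_pow (isOfFinOrder_z hk) h

theorem exists_eq_mul_z_sub_one (hk : 1 ≤ k) (r : ZHk k) (h : r * nu k = 0) :
    ∃ s, r = s * (z k - 1) := by
  rw [nu_eq] at h
  exact exists_eq_mul_sub_one_of_mul_sum_pow (isOfFinOrder_z hk) h

/-- The ring homomorphism `ℤ H_k → ℤ[ℤ²]`. -/
noncomputable def projRing (k : ℕ) : ZHk k →+* MonoidAlgebra ℤ Z2 :=
  mapDomainRingHom ℤ (proj k)

theorem projRing_gen (k : ℕ) (a : Gen) : projRing k (gen k a) = of ℤ Z2 (abGen a) := by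
  rw [gen_eq, projRing, of_apply, mapDomainRingHom_apply, mapDomain_single, proj_ofGen, of_apply]

theorem projRing_z (k : ℕ) : projRing k (z k) = 1 := by
  rw [projRing_gen]; exact map_one _

theorem exists_of_projRing_eq_zero {r : ZHk k} (h : projRing k r = 0) :
    ∃ s, r = s * (z k - 1) :=
  exists_eq_mul_sub_one (f := proj k) (fun _ _ => proj_eq_iff) h

theorem projRing_surjective (k : ℕ) : Function.Surjective (projRing k) := by
  intro s
  induction s using MonoidAlgebra.induction_linear with
  | zero => exact ⟨0, map_zero _⟩
  | add s t hs ht =>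
    obtain ⟨a, rfl⟩ := hs
    obtain ⟨b, rfl⟩ := ht
    exact ⟨a + b, map_add _ _ _⟩
  | single g n =>
    obtain ⟨h, rfl⟩ := proj_surjective k g
    exact ⟨single h n, by rw [projRing, mapDomainRingHom_apply, mapDomain_single]⟩

theorem exists_of_mul_one_sub (b c : ZHk k)
    (h : b * (1 - z k * y k) + c * (1 - z k) = 0) : ∃ s, b = s * (z k - 1) := by
  refine exists_of_projRing_eq_zero ?_
  have h' := congrArg (projRing k) h
  simp only [map_add, map_mul, map_sub, map_one, map_zero, projRing_z, sub_self, mul_zero,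
    add_zero, one_mul] at h'
  refine (mul_eq_zero.mp h').resolve_right ?_
  rw [← ne_eq, projRing_gen, ← neg_ne_zero, neg_sub]
  exact single_sub_one_ne_zero (by simp [abGen])

/-- Modulo z - 1 this is the Koszul relation, as 1 - zy and x - z reduce to 1 - y and x - 1. Lifting
the coefficient ρ leaves errors in R (z - 1). -/
theorem exists_of_koszul (a b c : ZHk k)
    (h : a * (x k - 1) + b * (y k - 1) + c * (z k - 1) = 0) :
    ∃ r s s' : ZHk k, a = r * (1 - z k * y k) + s * (1 - z k) ∧
      b = r * (x k - z k) + s' * (1 - z k) := by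
  have h' := congrArg (projRing k) h
  simp only [map_add, map_mul, map_sub, map_one, map_zero, projRing_z, sub_self, mul_zero,
    add_zero] at h'
  rw [projRing_gen, projRing_gen] at h'
  obtain ⟨ρ, ha, hb⟩ := koszul_exact h'
  obtain ⟨r, rfl⟩ := projRing_surjective k ρ
  obtain ⟨s, hs⟩ := exists_of_projRing_eq_zero (r := a - r * (1 - z k * y k)) (by
    simp only [map_mul, map_sub, map_one, projRing_z, one_mul]
    rw [ha, projRing_gen, sub_self])
  obtain ⟨s', hs'⟩ := exists_of_projRing_eq_zero (r := b - r * (x k - z k)) (by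
    simp only [map_mul, map_sub, projRing_z]
    rw [hb, projRing_gen, sub_self])
  refine ⟨r, -s, -s', ?_, ?_⟩
  · rw [neg_mul, ← mul_neg, neg_sub, ← hs]; abel
  · rw [neg_mul, ← mul_neg, neg_sub, ← hs']; abel

end Relations

/-! ### The complex, its exactness, and periodicity -/

section Exactness

variable {k : ℕ}

theorem vecMul_D1 (v : Fin 3 → ZHk k) : Matrix.vecMul v (D1 k) =
    ![v 0 * (x k - 1) + v 1 * (y k - 1) + v 2 * (z k - 1)] := by
  ext1 i
  fin_cases i
  simp [Matrix.vecMul, dotProduct, D1, Fin.sum_univ_succ, add_assoc]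

theorem vecMul_D2 (v : Fin 4 → ZHk k) : Matrix.vecMul v (D2 k) =
    ![v 1 * (1 - z k * y k) + v 2 * (1 - z k), v 1 * (x k - z k) + v 3 * (1 - z k),
      v 0 * nu k - v 1 + v 2 * (x k - 1) + v 3 * (y k - 1)] := by
  ext1 i
  fin_cases i <;> simp [Matrix.vecMul, dotProduct, D2, Fin.sum_univ_succ, add_assoc, sub_eq_add_neg]

theorem vecMul_D3 (v : Fin 4 → ZHk k) : Matrix.vecMul v (D3 k) =
    ![v 0 * (x k - 1) + v 1 * (y k - 1) + v 2 * (z k - 1), v 3 * (z k - 1),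
      -(v 0 * nu k) + v 3 * (1 - z k * y k), -(v 1 * nu k) + v 3 * (x k - z k)] := by
  ext1 i
  fin_cases i <;> simp [Matrix.vecMul, dotProduct, D3, Fin.sum_univ_succ, add_assoc]

theorem vecMul_D4 (v : Fin 4 → ZHk k) : Matrix.vecMul v (D4 k) =
    ![v 1 * (1 - z k * y k) + v 2 * (1 - z k), v 1 * (x k - z k) + v 3 * (1 - z k),
      v 0 * nu k - v 1 + v 2 * (x k - 1) + v 3 * (y k - 1), v 1 * nu k] := by
  ext1 i
  fin_cases i <;> simp [Matrix.vecMul, dotProduct, D4, Fin.sum_univ_succ, add_assoc, sub_eq_add_neg]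

theorem D2_mul_D1 (k : ℕ) : D2 k * D1 k = 0 := by
  have H := relations k
  ext1 i j
  fin_cases i <;> fin_cases j <;> simp [D1, D2, Matrix.mul_apply, Fin.sum_univ_succ, mul_sub,
    sub_mul, mul_assoc, H.xy, H.xz, H.yz, H.Nz] <;> abel

theorem D3_mul_D2 (k : ℕ) : D3 k * D2 k = 0 := by
  have H := relations k
  ext1 i j
  fin_cases i <;> fin_cases j <;> simp [D3, D2, Matrix.mul_apply, Fin.sum_univ_succ, mul_sub,
    sub_mul, mul_assoc, H.xy, H.xz, H.yz, H.Nz, H.zN, H.xN, H.yN] <;> abel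

theorem D4_mul_D3 (k : ℕ) : D4 k * D3 k = 0 := by
  have H := relations k
  ext1 i j
  fin_cases i <;> fin_cases j <;> simp [D3, D4, Matrix.mul_apply, Fin.sum_univ_succ, mul_sub,
    sub_mul, mul_assoc, H.xy, H.xz, H.yz, H.Nz, H.zN, H.xN, H.yN, mul_left_absorb H.Nz,
    mul_left_absorb H.zN] <;> abel

theorem D3_mul_D4 (k : ℕ) : D3 k * D4 k = 0 := by
  have H := relations k
  ext1 i j
  fin_cases i <;> fin_cases j <;> simp [D3, D4, Matrix.mul_apply, Fin.sum_univ_succ, mul_sub,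
    sub_mul, mul_assoc, H.xy, H.xz, H.yz, H.Nz, H.zN, H.xN, H.yN] <;> abel

theorem exact_vecMulLinear {l m n : Type*} [Fintype l] [Fintype m] [Fintype n] {R : Type*} [Ring R]
    {A : Matrix l m R} {B : Matrix m n R} (h : A * B = 0)
    (hex : ∀ v, Matrix.vecMul v B = 0 → ∃ w, Matrix.vecMul w A = v) :
    Function.Exact A.vecMulLinear B.vecMulLinear := by
  intro v
  constructor
  · exact hex v
  · rintro ⟨w, rfl⟩
    change Matrix.vecMul (Matrix.vecMul w A) B = 0
    rw [Matrix.vecMul_vecMul, h, Matrix.vecMul_zero]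

theorem exact_D2_D1 (hk : 1 ≤ k) :
    Function.Exact (D2 k).vecMulLinear (D1 k).vecMulLinear := by
  refine exact_vecMulLinear (D2_mul_D1 k) fun v hv => ?_
  rw [vecMul_D1] at hv
  obtain ⟨p, q, r, s, h₀, h₁, h₂⟩ := (relations k).exists_of_degree_one (exists_eq_mul_nu hk)
    exists_of_koszul (congrFun hv 0)
  refine ⟨![p, q, r, s], ?_⟩
  rw [vecMul_D2]
  ext1 i
  fin_cases i
  exacts [h₀, h₁, h₂]

theorem exact_D3_D2 (hk : 1 ≤ k) :
    Function.Exact (D3 k).vecMulLinear (D2 k).vecMulLinear := by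
  refine exact_vecMulLinear (D3_mul_D2 k) fun v hv => ?_
  rw [vecMul_D2] at hv
  obtain ⟨p, q, r, s, h₀, h₁, h₂, h₃⟩ := (relations k).exists_of_even_degree
    (exists_eq_mul_nu hk) (exists_eq_mul_z_sub_one hk) exists_of_mul_one_sub
    (congrFun hv 0) (congrFun hv 1) (congrFun hv 2)
  refine ⟨![p, q, r, s], ?_⟩
  rw [vecMul_D3]
  ext1 i
  fin_cases i
  exacts [h₀, h₁, h₂, h₃]

theorem exact_D3_D4 (hk : 1 ≤ k) :
    Function.Exact (D3 k).vecMulLinear (D4 k).vecMulLinear := by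
  refine exact_vecMulLinear (D3_mul_D4 k) fun v hv => ?_
  rw [vecMul_D4] at hv
  obtain ⟨p, q, r, s, h₀, h₁, h₂, h₃⟩ := (relations k).exists_of_even_degree
    (exists_eq_mul_nu hk) (exists_eq_mul_z_sub_one hk) exists_of_mul_one_sub
    (congrFun hv 0) (congrFun hv 1) (congrFun hv 2)
  refine ⟨![p, q, r, s], ?_⟩
  rw [vecMul_D3]
  ext1 i
  fin_cases i
  exacts [h₀, h₁, h₂, h₃]

theorem exact_D4_D3 (hk : 1 ≤ k) :
    Function.Exact (D4 k).vecMulLinear (D3 k).vecMulLinear := by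
  refine exact_vecMulLinear (D4_mul_D3 k) fun v hv => ?_
  rw [vecMul_D3] at hv
  obtain ⟨p, q, r, s, h₀, h₁, h₂, h₃⟩ := (relations k).exists_of_odd_degree
    (exists_eq_mul_nu hk) (exists_eq_mul_z_sub_one hk)
    (congrFun hv 0) (congrFun hv 1) (congrFun hv 2) (congrFun hv 3)
  refine ⟨![p, q, r, s], ?_⟩
  rw [vecMul_D4]
  ext1 i
  fin_cases i
  exacts [h₀, h₁, h₂, h₃]

/-- The augmentation as an integer-valued additive map. -/
noncomputable def integerAugmentation (k : ℕ) : ZHk k →+ ℤ where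
  toFun r := (Representation.trivial ℤ (Hk k) ℤ).asModuleEquiv (augmentation k fun _ => r)
  map_zero' := by
    rw [show (fun _ => 0 : M k 0) = 0 from rfl, map_zero, map_zero]
  map_add' r s := by
    rw [← map_add, ← map_add]; rfl

theorem integerAugmentation_single (g : Hk k) : integerAugmentation k (single g 1) = 1 :=
  augmentation_of k g

theorem augmentation_eq_zero_iff (v : M k 0) :
    augmentation k v = 0 ↔ integerAugmentation k (v (0 : Fin 1)) = 0 := by
  have : v = fun _ => v (0 : Fin 1) := by
    ext1 i
    rw [Subsingleton.elim (α := Fin 1) i 0]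
  rw [this]
  exact ((Representation.trivial ℤ (Hk k) ℤ).asModuleEquiv.map_eq_zero_iff).symm

theorem augmentation_surjective (k : ℕ) : Function.Surjective (augmentation k) := by
  intro n
  refine ⟨fun _ => ((Representation.trivial ℤ (Hk k) ℤ).asModuleEquiv n : ℤ) • 1, ?_⟩
  apply (Representation.trivial ℤ (Hk k) ℤ).asModuleEquiv.injective
  change integerAugmentation k _ = _
  rw [map_zsmul, one_def, integerAugmentation_single]
  simp

theorem exact_D1_augmentation (k : ℕ) : Function.Exact (diff k 0) (augmentation k) := by
  intro v
  constructor
  · intro hv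
    rw [augmentation_eq_zero_iff] at hv
    -- The image of ∂₁ is a left ideal L. The g with g - 1 ∈ L form a subgroup containing the
    -- generators, hence all of H_k.
    let L : Ideal (ZHk k) := LinearMap.range ((LinearMap.proj (0 : Fin 1)).comp (diff k 0))
    have hL : ∀ a, gen k a - 1 ∈ L := by
      intro a
      have key : ∀ w : Fin 3 → ZHk k,
          w 0 * (x k - 1) + w 1 * (y k - 1) + w 2 * (z k - 1) ∈ L :=
        fun w => ⟨w, congrFun (vecMul_D1 w) 0⟩
      cases a
      · simpa using key ![1, 0, 0]
      · simpa using key ![0, 1, 0]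
      · simpa using key ![0, 0, 1]
    have htop : subgroupOfIdeal L = ⊤ := by
      rw [eq_top_iff, ← closure_range_ofGen, Subgroup.closure_le]
      rintro _ ⟨a, rfl⟩
      exact hL a
    -- Collapsing H_k to a point is the augmentation in disguise, so its kernel is spanned by
    -- differences of group elements.
    let m : ZHk k →+ MonoidAlgebra ℤ Unit :=
      ⟨⟨mapDomain fun _ => (), mapDomain_zero _⟩, mapDomain_add _⟩
    have hm : m = (AddMonoidHom.mk' (fun n : ℤ => (single () n : MonoidAlgebra ℤ Unit))
        fun a b => single_add _ _ _).comp (integerAugmentation k) := by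
      refine addMonoidHom_eq_of_single fun g => ?_
      change mapDomain _ _ = single () (integerAugmentation k _)
      rw [mapDomain_single, integerAugmentation_single]
    have hmem : v (0 : Fin 1) ∈ L := by
      refine mem_of_mapDomain_eq_zero (f := fun _ => ()) (L := L.toAddSubgroup)
        (fun g h _ => single_sub_single_mem (htop ▸ Subgroup.mem_top _)) ?_
      change m _ = 0
      rw [hm, AddMonoidHom.comp_apply, hv, map_zero]
    obtain ⟨w, hw⟩ := hmem
    refine ⟨w, ?_⟩
    ext1 i
    rw [Subsingleton.elim (α := Fin 1) i 0]
    exact hw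
  · rintro ⟨w, rfl⟩
    have hgen : ∀ a r, augmentation k (fun _ => r * (gen k a - 1)) = 0 := by
      intro a r
      have : (fun _ => r * (gen k a - 1) : M k 0) = r • fun _ => gen k a - 1 := rfl
      rw [this, map_smul, (augmentation_eq_zero_iff _).mpr, smul_zero]
      change integerAugmentation k (single (ofGen k a) 1 - 1) = 0
      rw [map_sub, one_def, integerAugmentation_single, integerAugmentation_single, sub_self]
    have hw : diff k 0 w = (fun _ => w (0 : Fin 3) * (x k - 1)) +
        (fun _ => w (1 : Fin 3) * (y k - 1)) + fun _ => w (2 : Fin 3) * (z k - 1) := by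
      refine (vecMul_D1 w).trans ?_
      ext1 i
      rw [Subsingleton.elim (α := Fin 1) i 0]
      rfl
    rw [hw, map_add, map_add, hgen, hgen, hgen, add_zero, add_zero]

theorem isFreeResolution (hk : 1 ≤ k) : IsFreeResolution (diff k) (augmentation k) where
  free n := inferInstance
  surjective := augmentation_surjective k
  exact_zero := exact_D1_augmentation k
  exact_succ n := by
    match n with
    | 0 => exact exact_D2_D1 hk
    | 1 =>
      have h : diffMatrix k (0 + 2) = D3 k := by
        simp [diffMatrix]
        rfl
      change Function.Exact (diffMatrix k (0 + 2)).vecMulLinear (D2 k).vecMulLinear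
      rw [h]
      exact exact_D3_D2 hk
    -- The differential with index n + 2 leaves degree n + 3, so even n corresponds to ∂₃.
    | n + 2 =>
      by_cases hn : Even n
      · have h₀ : diffMatrix k (n + 2) = D3 k := if_pos hn
        have h₁ : diffMatrix k (n + 3) = D4 k := if_neg (by simpa [Nat.even_add_one] using hn)
        rw [diff, diff, h₀, h₁]
        exact exact_D4_D3 hk
      · have h₀ : diffMatrix k (n + 2) = D4 k := if_neg hn
        have h₁ : diffMatrix k (n + 3) = D3 k := if_pos (by simpa [Nat.even_add_one] using hn)
        rw [diff, diff, h₀, h₁]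
        exact exact_D3_D4 hk

theorem rk_of_two_le {j : ℕ} (hj : 2 ≤ j) : rk j = 4 := by
  obtain ⟨i, rfl⟩ := Nat.exists_eq_add_of_le' hj
  rfl

theorem isPeriodicFrom (k : ℕ) : IsPeriodicFrom 2 2 (diff k) := by
  refine ⟨fun j hj => LinearEquiv.funCongrLeft (ZHk k) (ZHk k)
    (finCongr ((rk_of_two_le hj).trans (rk_of_two_le (Nat.le_add_right 2 j)).symm)), ?_⟩
  intro j hj v
  obtain ⟨i, rfl⟩ := Nat.exists_eq_add_of_le' hj
  have h : diffMatrix k (2 + (i + 2)) = diffMatrix k (i + 2) := by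
    change (if Even (2 + i) then D3 k else D4 k) = if Even i then D3 k else D4 k
    simp [Nat.even_add]
  -- For j = i + 2 both ranks reduce to 4 and the reindexing is the identity, so only equality of
  -- the matrices remains.
  exact congrArg (Matrix.vecMul v) h

end Exactness

end Heisenberg

theorem mainTheorem5 (k : ℕ) (hk : 1 ≤ k) :
    IsFreeResolution (Heisenberg.diff k) (Heisenberg.augmentation k) ∧
      IsPeriodicFrom 2 2 (Heisenberg.diff k) ∧
      HasStableRankFrom (Heisenberg.ZHk k) (Heisenberg.M k) 2 4 :=
  ⟨Heisenberg.isFreeResolution hk, Heisenberg.isPeriodicFrom k, fun _ hj =>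
    ⟨LinearEquiv.funCongrLeft _ _ (finCongr (Heisenberg.rk_of_two_le hj).symm)⟩⟩
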